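/- A bar-partition is a partition $\lambda$ into distinct positive parts. For a part $a$ of $\lambda$, the bar lengths in the row of $a$ are the elements of $$\bigl(\{1,\dots,a\}\cup\{a+b : b \text{ a part},\, b<a\}\bigr)\setminus\{a-b : b \text{ a part},\, b<a\};$$ each such element $l$ is the length of one bar. Removing a bar of length $l\le a$ replaces the part $a$ by $a-l$ (deleting it if $l=a$); removing a bar of length $l=a+b$ deletes the two parts $a$ and $b$. For an odd positive integer $\ell$, $\lambda$ is an $\bar\ell$-core if it has no bar of length divisible by $\ell$, and the $\bar\ell$-core of $\lambda$ is the bar-partition obtained from $\lambda$ by successively removing all bars of length divisible by $\ell$ until none is left (it does not depend on the order of the removals). Theorem. For any two odd positive integers $s$ and $t$ (not necessarily coprime), the $\bar s$-core of a $\bar t$-core bar-partition is again a $\bar t$-core. -/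

import Mathlib

/-- A bar-partition: a partition into distinct parts, given by its finite set of parts,
which are positive integers. -/
@[ext]
structure BarPartition where
  /-- the set of parts -/
  parts : Finset ℕ
  /-- the parts are positive -/
  zero_notMem : 0 ∉ parts

namespace BarPartition

/-- The integer that is partitioned. -/
def size (lam : BarPartition) : ℕ := ∑ a ∈ lam.parts, a

/-- The lengths of the bars that start in the row of the part `a`: the set
`{1, …, a} ∪ {a + b | b a smaller part} \ {a - b | b a smaller part}`.
It has `a` elements (see `card_barLengths`). Written in decreasing order, they are attached to
the `a` nodes of the row of the part `a` in the shifted Young diagram. -/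
def barLengths (lam : BarPartition) (a : ℕ) : Finset ℕ :=
  (Finset.Icc 1 a ∪ (lam.parts.filter (fun b => b < a)).image (fun b => a + b)) \
    (lam.parts.filter (fun b => b < a)).image (fun b => a - b)

/-- `lam` has a bar of length `l` in the row of the part `a`. -/
def IsBar (lam : BarPartition) (a l : ℕ) : Prop :=
  a ∈ lam.parts ∧ l ∈ lam.barLengths a

/-- Removal of the bar of length `l` in the row of the part `a`. If `l ≤ a`, the part `a` is
replaced by `a - l` (and simply deleted if `l = a`); if `l > a`, so that `l = a + b` for a smaller
part `b`, the two parts `a` and `b` are deleted. -/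
def removeBar (lam : BarPartition) (a l : ℕ) : BarPartition where
  parts := if l ≤ a then (insert (a - l) (lam.parts.erase a)).erase 0
    else (lam.parts.erase a).erase (l - a)
  zero_notMem := by
    have h := lam.zero_notMem
    split_ifs <;> simp [h]

/-- `mu` is obtained from `lam` by the removal of one bar of length divisible by `ℓ`. -/
def RemovesTo (ℓ : ℕ) (lam mu : BarPartition) : Prop :=
  ∃ a l : ℕ, lam.IsBar a l ∧ ℓ ∣ l ∧ mu = lam.removeBar a l

/-- `lam` is an `ℓ`-bar-core: it has no bar of length divisible by `ℓ`. -/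
def IsBarCore (ℓ : ℕ) (lam : BarPartition) : Prop :=
  ∀ a l : ℕ, lam.IsBar a l → ¬ ℓ ∣ l

/-- `mu` is a result of removing from `lam`, one after the other and in some order, all the bars
of length divisible by `ℓ`, until none is left. -/
def IsBarCoreOf (ℓ : ℕ) (lam mu : BarPartition) : Prop :=
  Relation.ReflTransGen (RemovesTo ℓ) lam mu ∧ mu.IsBarCore ℓ

/-- The description of the bars in terms of the parts. -/
theorem isBar_iff (lam : BarPartition) (a l : ℕ) :
    lam.IsBar a l ↔ a ∈ lam.parts ∧
      ((1 ≤ l ∧ l ≤ a ∧ a - l ∉ lam.parts) ∨ (∃ b ∈ lam.parts, b < a ∧ l = a + b)) := by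
  have h0 := lam.zero_notMem
  unfold IsBar barLengths
  refine and_congr_right fun ha => ?_
  simp only [Finset.mem_sdiff, Finset.mem_union, Finset.mem_Icc, Finset.mem_image,
    Finset.mem_filter]
  constructor
  · rintro ⟨⟨h1, h2⟩ | ⟨b, ⟨hb, hba⟩, rfl⟩, h3⟩
    · refine Or.inl ⟨h1, h2, fun hm => h3 ⟨a - l, ⟨hm, by omega⟩, by omega⟩⟩
    · exact Or.inr ⟨b, hb, hba, rfl⟩
  · rintro (⟨h1, h2, h3⟩ | ⟨b, hb, hba, rfl⟩)
    · refine ⟨Or.inl ⟨h1, h2⟩, ?_⟩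
      rintro ⟨b, ⟨hb, hba⟩, rfl⟩
      apply h3
      rwa [show a - (a - b) = b by omega]
    · refine ⟨Or.inr ⟨b, ⟨hb, hba⟩, rfl⟩, ?_⟩
      rintro ⟨c, ⟨hc, hca⟩, h⟩
      have : b = 0 := by omega
      exact h0 (this ▸ hb)

/-- There are as many bars in the row of `a` as this row has nodes. -/
theorem card_barLengths (lam : BarPartition) (a : ℕ) : (lam.barLengths a).card = a := by
  have h0 := lam.zero_notMem
  have hpos : ∀ b ∈ lam.parts, 0 < b := fun b hb =>
    Nat.pos_of_ne_zero fun h => h0 (h ▸ hb)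
  unfold barLengths
  rw [Finset.card_sdiff_of_subset, Finset.card_union_of_disjoint]
  · rw [Finset.card_image_of_injOn, Finset.card_image_of_injOn]
    · simp
    · intro x hx y hy h
      simp only [Finset.coe_filter, Set.mem_ofPred_eq] at hx hy h
      omega
    · intro x hx y hy h
      simpa using h
  · rw [Finset.disjoint_left]
    intro x hx hx'
    simp only [Finset.mem_Icc, Finset.mem_image, Finset.mem_filter] at hx hx'
    obtain ⟨b, ⟨hb, -⟩, rfl⟩ := hx'
    have := hpos b hb
    omega
  · intro x hx
    simp only [Finset.mem_image, Finset.mem_filter] at hx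
    obtain ⟨b, ⟨hb, hba⟩, rfl⟩ := hx
    have := hpos b hb
    simp only [Finset.mem_union, Finset.mem_Icc]
    left; omega

/-- For every function `w` with `w 0 = 0`, the effect of the removal of a bar on `∑ w`. -/
theorem sum_removeBar {M : Type*} [AddCommGroup M] {lam : BarPartition} {a l : ℕ}
    (h : lam.IsBar a l) (w : ℕ → M) (hw : w 0 = 0) :
    (l ≤ a ∧ ∑ x ∈ (lam.removeBar a l).parts, w x + w a = ∑ x ∈ lam.parts, w x + w (a - l)) ∨
    (a < l ∧ ∑ x ∈ (lam.removeBar a l).parts, w x + w a + w (l - a) = ∑ x ∈ lam.parts, w x) := by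
  rw [isBar_iff] at h
  obtain ⟨ha, ⟨h1, h2, h3⟩ | ⟨b, hb, hba, rfl⟩⟩ := h
  · left
    refine ⟨h2, ?_⟩
    simp only [removeBar, if_pos h2]
    rw [Finset.sum_erase _ hw, Finset.sum_insert (by simp [h3])]
    rw [← Finset.sum_erase_add _ _ ha]
    abel
  · right
    have hb0 : b ≠ 0 := fun h => lam.zero_notMem (h ▸ hb)
    refine ⟨by omega, ?_⟩
    have : ¬ (a + b ≤ a) := by omega
    simp only [removeBar, if_neg this, Nat.add_sub_cancel_left]
    have hb' : b ∈ lam.parts.erase a := Finset.mem_erase.2 ⟨by omega, hb⟩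
    rw [← Finset.sum_erase_add _ _ ha, ← Finset.sum_erase_add _ _ hb']
    abel

/-- The removal of a bar of length `l` lowers the size by `l`. -/
theorem size_removeBar {lam : BarPartition} {a l : ℕ} (h : lam.IsBar a l) :
    (lam.removeBar a l).size + l = lam.size := by
  have h' := sum_removeBar h (fun x => (x : ℤ)) (by simp)
  unfold size
  zify
  rcases h' with ⟨h1, h2⟩ | ⟨h1, h2⟩
  · push_cast [h1] at h2; linarith
  · push_cast [h1.le] at h2; linarith

/-- All the bars of length divisible by `ℓ` can be removed. -/
theorem exists_isBarCoreOf (ℓ : ℕ) (lam : BarPartition) : ∃ mu, IsBarCoreOf ℓ lam mu := by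
  induction hn : lam.size using Nat.strong_induction_on generalizing lam with
  | _ n ih =>
    by_cases hc : lam.IsBarCore ℓ
    · exact ⟨lam, Relation.ReflTransGen.refl, hc⟩
    · unfold IsBarCore at hc
      push Not at hc
      obtain ⟨a, l, hb, hl⟩ := hc
      have hpos : 0 < l := by
        rcases ((isBar_iff _ _ _).1 hb).2 with h | ⟨b, -, h1, h2⟩ <;> omega
      have hs := size_removeBar hb
      obtain ⟨mu, h1, h2⟩ := ih _ (by omega) (lam.removeBar a l) rfl
      exact ⟨mu, Relation.ReflTransGen.head ⟨a, l, hb, hl, rfl⟩ h1, h2⟩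

/-- The `ℓ`-bar-core of `lam`: what is left when all the bars of length divisible by `ℓ` have been
removed from `lam`. For odd `ℓ` the order of the removals does not matter
(see `IsBarCoreOf.eq_barCore`). -/
noncomputable def barCore (ℓ : ℕ) (lam : BarPartition) : BarPartition :=
  (exists_isBarCoreOf ℓ lam).choose

theorem barCore_spec (ℓ : ℕ) (lam : BarPartition) : IsBarCoreOf ℓ lam (barCore ℓ lam) :=
  (exists_isBarCoreOf ℓ lam).choose_spec

/-- The number of parts congruent to `x` minus the number of parts congruent to `-x` does not
change when bars of length divisible by `ℓ` are removed. -/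
theorem residue_invariant {ℓ : ℕ} {lam mu : BarPartition}
    (h : Relation.ReflTransGen (RemovesTo ℓ) lam mu) (x : ℕ) :
    ∑ y ∈ mu.parts, ((if (ℓ : ℤ) ∣ y - x then 1 else 0) - (if (ℓ : ℤ) ∣ y + x then 1 else 0) : ℤ) =
    ∑ y ∈ lam.parts,
      ((if (ℓ : ℤ) ∣ y - x then 1 else 0) - (if (ℓ : ℤ) ∣ y + x then 1 else 0) : ℤ) := by
  induction h with
  | refl => rfl
  | tail _ hstep ih =>
    rw [← ih]
    obtain ⟨a, l, hb, ⟨k, rfl⟩, rfl⟩ := hstep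
    have hs := sum_removeBar hb (fun y : ℕ =>
      ((if (ℓ : ℤ) ∣ y - x then 1 else 0) - (if (ℓ : ℤ) ∣ y + x then 1 else 0) : ℤ)) (by simp)
    rcases hs with ⟨h1, h2⟩ | ⟨h1, h2⟩
    · have e1 : (ℓ : ℤ) ∣ ((a - ℓ * k : ℕ) : ℤ) - x ↔ (ℓ : ℤ) ∣ a - x := by
        push_cast [h1]
        rw [show (a : ℤ) - ℓ * k - x = (a - x) - ℓ * k by ring]
        exact dvd_sub_left (dvd_mul_right _ _)
      have e2 : (ℓ : ℤ) ∣ ((a - ℓ * k : ℕ) : ℤ) + x ↔ (ℓ : ℤ) ∣ a + x := by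
        push_cast [h1]
        rw [show (a : ℤ) - ℓ * k + x = (a + x) - ℓ * k by ring]
        exact dvd_sub_left (dvd_mul_right _ _)
      simp only [e1, e2] at h2
      linarith
    · have e1 : (ℓ : ℤ) ∣ ((ℓ * k - a : ℕ) : ℤ) - x ↔ (ℓ : ℤ) ∣ a + x := by
        push_cast [h1.le]
        rw [show (ℓ : ℤ) * k - a - x = ℓ * k - (a + x) by ring]
        exact dvd_sub_right (dvd_mul_right _ _)
      have e2 : (ℓ : ℤ) ∣ ((ℓ * k - a : ℕ) : ℤ) + x ↔ (ℓ : ℤ) ∣ a - x := by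
        push_cast [h1.le]
        rw [show (ℓ : ℤ) * k - a + x = ℓ * k - (a - x) by ring]
        exact dvd_sub_right (dvd_mul_right _ _)
      simp only [e1, e2] at h2
      linarith

/-- One inclusion of the uniqueness of bar-cores. -/
theorem core_subset {ℓ : ℕ} (hℓ : Odd ℓ) {lam mu : BarPartition}
    (h1 : lam.IsBarCore ℓ) (h2 : mu.IsBarCore ℓ)
    (h : ∀ x : ℕ,
      ∑ y ∈ mu.parts,
        ((if (ℓ : ℤ) ∣ y - x then 1 else 0) - (if (ℓ : ℤ) ∣ y + x then 1 else 0) : ℤ) =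
      ∑ y ∈ lam.parts,
        ((if (ℓ : ℤ) ∣ y - x then 1 else 0) - (if (ℓ : ℤ) ∣ y + x then 1 else 0) : ℤ)) :
    lam.parts ⊆ mu.parts := by
  intro x hx
  by_contra hx'
  have h0 := lam.zero_notMem
  have hx0 : 0 < x := Nat.pos_of_ne_zero fun e => h0 (e ▸ hx)
  have hdx : ¬ ℓ ∣ x := h1 x x ((isBar_iff _ _ _).2 ⟨hx, Or.inl ⟨hx0, le_rfl, by simpa using h0⟩⟩)
  have hno : ∀ y ∈ lam.parts, ¬ (ℓ : ℤ) ∣ y + x := by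
    intro y hy hd
    have hd' : ℓ ∣ y + x := by exact_mod_cast hd
    rcases lt_trichotomy y x with hlt | rfl | hlt
    · exact h1 x (x + y) ((isBar_iff _ _ _).2 ⟨hx, Or.inr ⟨y, hy, hlt, rfl⟩⟩) (add_comm y x ▸ hd')
    · have : ℓ ∣ 2 * y := by rwa [two_mul]
      exact hdx ((Nat.Coprime.dvd_mul_left (Nat.coprime_two_right.2 hℓ)).1 this)
    · exact h1 y (y + x) ((isBar_iff _ _ _).2 ⟨hy, Or.inr ⟨x, hx, hlt, rfl⟩⟩) hd'
  have hs := h x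
  rw [Finset.sum_sub_distrib, Finset.sum_sub_distrib, Finset.sum_boole, Finset.sum_boole,
    Finset.sum_boole, Finset.sum_boole, Finset.filter_false_of_mem hno] at hs
  have hlt : (mu.parts.filter (fun y : ℕ => (ℓ : ℤ) ∣ y - x)).card <
      (lam.parts.filter (fun y : ℕ => (ℓ : ℤ) ∣ y - x)).card := by
    apply Finset.card_lt_card
    rw [Finset.ssubset_iff_of_subset]
    · exact ⟨x, by simp [hx], by simp [hx']⟩
    · intro y hy
      rw [Finset.mem_filter] at hy ⊢
      obtain ⟨hy, hd⟩ := hy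
      refine ⟨?_, hd⟩
      by_contra hy'
      rcases lt_trichotomy y x with hlt | rfl | hlt
      · refine h1 x (x - y) ((isBar_iff _ _ _).2 ⟨hx, Or.inl ⟨by omega, by omega, ?_⟩⟩) ?_
        · rwa [show x - (x - y) = y by omega]
        · zify [hlt.le]
          rwa [← dvd_neg, neg_sub]
      · exact hx' hy
      · refine h2 y (y - x) ((isBar_iff _ _ _).2 ⟨hy, Or.inl ⟨by omega, by omega, ?_⟩⟩) ?_
        · rwa [show y - (y - x) = x by omega]
        · zify [hlt.le]
          exact hd
  simp only [Finset.card_empty] at hs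
  push_cast at hs
  omega

/-- For odd `ℓ`, the result of removing all the bars of length divisible by `ℓ` does not depend on
the order of the removals. -/
theorem IsBarCoreOf.eq_barCore {ℓ : ℕ} (hℓ : Odd ℓ) {lam mu : BarPartition}
    (h : IsBarCoreOf ℓ lam mu) : mu = barCore ℓ lam := by
  have h' := barCore_spec ℓ lam
  have e := fun x => (residue_invariant h.1 x).trans (residue_invariant h'.1 x).symm
  exact BarPartition.ext (Finset.Subset.antisymm
    (core_subset hℓ h.2 h'.2 fun x => (e x).symm) (core_subset hℓ h'.2 h.2 e))

end BarPartition

/-!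
A bar-partition `lam` is encoded by the set `beads lam` of nonzero integers consisting of the parts
and of the negatives of the positive non-parts. Up to the position `0` this set is carried to its
complement by `x ↦ -x`, so that removing a bar of length `l` moves beads down by `l`. For odd `t`,
`lam` is a `t`-bar-core if and only if `beads lam` is stable under `x ↦ x - t`
(`isBarCore_iff_beads`): bar-cores become cores of ordinary partitions.

Removing bars of length divisible by `s` does not change the number of beads in a residue class
modulo `s` and a large window (`card_beadsIn_eq`), and in the `s`-bar-core the beads of each class
are pushed down as far as possible. Let `B` be the beads of a `t`-bar-core and `D` those of its
`s`-bar-core. The shift by `-t` embeds the part of `B` in the class of `x` into the part in the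
class of `x - t`, so that the class of `x` has at most as many beads as the class of `x - t`.
The same inequality then holds for `D`, and between two classes that are pushed down
it says that the shift of the first is contained in the second. Hence `D - t ⊆ D`.
-/

namespace BarPartition

/-- The bead set of a bar-partition: the parts, and the negatives of the positive integers that
are not parts. The position `0` is always empty. -/
def beads (lam : BarPartition) : Set ℤ :=
  {x | (0 < x ∧ x.toNat ∈ lam.parts) ∨ (x < 0 ∧ (-x).toNat ∉ lam.parts)}

theorem natCast_mem_beads (lam : BarPartition) (a : ℕ) : (a : ℤ) ∈ lam.beads ↔ a ∈ lam.parts := by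
  have h0 := lam.zero_notMem
  rcases Nat.eq_zero_or_pos a with rfl | ha
  · simp [beads, h0]
  · simp only [beads, Set.mem_ofPred_eq, Int.toNat_natCast]
    constructor
    · rintro (h | h)
      · exact h.2
      · omega
    · exact fun h => Or.inl ⟨by omega, h⟩

theorem neg_mem_beads (lam : BarPartition) {x : ℤ} (hx : x ≠ 0) :
    -x ∈ lam.beads ↔ x ∉ lam.beads := by
  simp only [beads, Set.mem_ofPred_eq, neg_neg]
  rcases lt_or_gt_of_ne hx with h | h
  · have h1 : ¬ 0 < x := by omega
    simp [h, h1]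
  · have h1 : ¬ x < 0 := by omega
    simp [h, h1]

theorem zero_notMem_beads (lam : BarPartition) : (0 : ℤ) ∉ lam.beads := by
  simp [beads]

theorem IsBarCore.sub_mem_beads {t : ℕ} (ht : Odd t) {lam : BarPartition} (h : lam.IsBarCore t)
    {x : ℤ} (hx : x ∈ lam.beads) : x - t ∈ lam.beads := by
  have htpos := ht.pos
  -- A bead at `a > 0` forces a bead at `a - t`, whether this position is positive or negative.
  have key : ∀ a : ℕ, a ∈ lam.parts → (a : ℤ) - t ∈ lam.beads := by
    intro a ha
    rcases le_or_gt t a with hta | hta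
    · rw [← Nat.cast_sub hta, natCast_mem_beads]
      by_contra hn
      exact h a t ((isBar_iff _ _ _).2 ⟨ha, Or.inl ⟨htpos, hta, hn⟩⟩) dvd_rfl
    · rw [← neg_sub, neg_mem_beads _ (by omega), ← Nat.cast_sub hta.le, natCast_mem_beads]
      intro hb
      rcases lt_trichotomy (t - a) a with hlt | heq | hlt
      · exact h a t ((isBar_iff _ _ _).2 ⟨ha, Or.inr ⟨_, hb, hlt, by omega⟩⟩) dvd_rfl
      · obtain ⟨k, hk⟩ := ht
        omega
      · exact h _ t ((isBar_iff _ _ _).2 ⟨hb, Or.inr ⟨_, ha, hlt, by omega⟩⟩) dvd_rfl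
  rcases le_or_gt x 0 with hx0 | hx0
  -- For `x < 0`, an empty position `x - t` means a bead at `t - x`, which moves down to `-x`.
  · by_contra hn
    have hne : x ≠ 0 := fun e => zero_notMem_beads lam (e ▸ hx)
    rw [← neg_mem_beads _ (by omega)] at hn
    obtain ⟨a, ha⟩ := Int.eq_ofNat_of_zero_le (show 0 ≤ -(x - t) by omega)
    rw [ha, natCast_mem_beads] at hn
    have := key a hn
    rw [show (a : ℤ) - t = -x by omega, neg_mem_beads _ hne] at this
    exact this hx
  · obtain ⟨a, rfl⟩ := Int.eq_ofNat_of_zero_le hx0.le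
    exact key a ((natCast_mem_beads _ _).1 hx)

theorem sub_mul_mem_beads {t : ℕ} {lam : BarPartition}
    (h : ∀ x ∈ lam.beads, x - t ∈ lam.beads) {x : ℤ} (hx : x ∈ lam.beads) (k : ℕ) :
    x - t * k ∈ lam.beads := by
  induction k with
  | zero => simpa using hx
  | succ k ih =>
    have := h _ ih
    rwa [show x - t * k - t = x - t * ((k + 1 : ℕ) : ℤ) by push_cast; ring] at this

/-- The bead set turns bar-cores into cores of ordinary partitions. The empty position `0` needs no
exception: neither side allows a part divisible by `t`. -/
theorem isBarCore_iff_beads {t : ℕ} (ht : Odd t) (lam : BarPartition) :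
    lam.IsBarCore t ↔ ∀ x ∈ lam.beads, x - t ∈ lam.beads := by
  refine ⟨fun h x hx => h.sub_mem_beads ht hx, ?_⟩
  rintro h a l hb ⟨k, rfl⟩
  rw [isBar_iff] at hb
  obtain ⟨ha, hb⟩ := hb
  have hk := sub_mul_mem_beads h ((natCast_mem_beads _ _).2 ha) k
  rcases hb with ⟨-, h2, h3⟩ | ⟨b, hb, -, h2⟩
  · apply h3
    rw [← natCast_mem_beads]
    push_cast [h2]
    exact hk
  · have hb0 : (b : ℤ) ≠ 0 := fun e => lam.zero_notMem (by simpa [Nat.cast_eq_zero.1 e] using hb)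
    have e : (a : ℤ) - t * k = -b := by zify at h2; linarith
    rw [e, neg_mem_beads _ hb0, natCast_mem_beads] at hk
    exact hk hb

open Classical in
/-- The indicator of the bead set, with values in the integers. -/
noncomputable def beadInd (lam : BarPartition) (x : ℤ) : ℤ := if x ∈ lam.beads then 1 else 0

open Classical in
/-- The beads in the residue class of `x` modulo `s` with positions in the window `[m, n]`. -/
noncomputable def beadsIn (lam : BarPartition) (s : ℕ) (x m n : ℤ) : Finset ℤ :=
  (Finset.Icc m n).filter (fun y => y ∈ lam.beads ∧ (s : ℤ) ∣ y - x)

theorem mem_beadsIn {lam : BarPartition} {s : ℕ} {x m n y : ℤ} :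
    y ∈ lam.beadsIn s x m n ↔ (m ≤ y ∧ y ≤ n) ∧ y ∈ lam.beads ∧ (s : ℤ) ∣ y - x := by
  simp [beadsIn]

theorem beadInd_neg (lam : BarPartition) {x : ℤ} (hx : x ≠ 0) :
    lam.beadInd (-x) = 1 - lam.beadInd x := by
  unfold beadInd
  rw [neg_mem_beads _ hx]
  split_ifs <;> simp_all

theorem card_beadsIn (lam : BarPartition) (s : ℕ) (x m n : ℤ) :
    ((lam.beadsIn s x m n).card : ℤ) =
      ∑ y ∈ Finset.Icc m n, lam.beadInd y * (if (s : ℤ) ∣ y - x then 1 else 0) := by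
  classical
  unfold beadsIn beadInd
  rw [← Finset.sum_boole]
  refine Finset.sum_congr rfl fun y _ => ?_
  split_ifs <;> simp_all

theorem sum_Icc_neg_natCast (f : ℤ → ℤ) (hf : f 0 = 0) (N : ℕ) :
    ∑ y ∈ Finset.Icc (-(N : ℤ)) N, f y = ∑ y ∈ Finset.range (N + 1), (f y + f (-y)) := by
  induction N with
  | zero => simp [hf]
  | succ N ih =>
    rw [Finset.sum_range_succ, ← ih]
    have e : Finset.Icc (-((N + 1 : ℕ) : ℤ)) ((N + 1 : ℕ) : ℤ) =
        insert (((N + 1 : ℕ) : ℤ)) (insert (-((N + 1 : ℕ) : ℤ)) (Finset.Icc (-(N : ℤ)) N)) := by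
      ext y
      simp only [Finset.mem_Icc, Finset.mem_insert]
      omega
    rw [e, Finset.sum_insert, Finset.sum_insert]
    · ring
    · simp only [Finset.mem_Icc]
      omega
    · simp only [Finset.mem_Icc, Finset.mem_insert]
      omega

theorem sum_parts_eq_sum_range (lam : BarPartition) {N : ℕ} (hN : ∀ a ∈ lam.parts, a ≤ N)
    (g : ℕ → ℤ) : ∑ y ∈ lam.parts, g y = ∑ y ∈ Finset.range (N + 1), lam.beadInd y * g y := by
  classical
  have e : lam.parts = (Finset.range (N + 1)).filter (· ∈ lam.parts) := by
    ext y
    simp only [Finset.mem_filter, Finset.mem_range]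
    exact ⟨fun h => ⟨by have := hN y h; omega, h⟩, fun h => h.2⟩
  conv_lhs => rw [e]
  rw [Finset.sum_filter]
  refine Finset.sum_congr rfl fun y _ => ?_
  simp only [beadInd, natCast_mem_beads]
  split_ifs <;> simp

theorem beadInd_of_gt {lam : BarPartition} {N : ℕ} (hN : ∀ a ∈ lam.parts, a ≤ N) {y : ℤ}
    (hy : N < y) : lam.beadInd y = 0 := by
  obtain ⟨a, rfl⟩ := Int.eq_ofNat_of_zero_le (show 0 ≤ y by omega)
  simp only [beadInd, natCast_mem_beads, ite_eq_right_iff, one_ne_zero, imp_false]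
  intro h
  have := hN a h
  omega

/-- The numbers of beads in a residue class and in a window that contains all parts and their
negatives are preserved by the removal of bars of length divisible by `s`. -/
theorem card_beadsIn_eq {s : ℕ} (hs : 0 < s) {lam mu : BarPartition}
    (h : Relation.ReflTransGen (RemovesTo s) lam mu) {N : ℕ} (hlam : ∀ a ∈ lam.parts, a ≤ N)
    (hmu : ∀ a ∈ mu.parts, a ≤ N) (x : ℤ) {m n : ℤ} (hm : m ≤ -N) (hn : N ≤ n) :
    (mu.beadsIn s x m n).card = (lam.beadsIn s x m n).card := by
  -- The residue class has a representative in `ℕ`, as the residue invariant requires.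
  obtain ⟨r, hr⟩ := Int.eq_ofNat_of_zero_le (Int.emod_nonneg x (show (s : ℤ) ≠ 0 by omega))
  have hxr : (s : ℤ) ∣ x - r := by
    have := Int.emod_add_mul_ediv x s
    exact ⟨x / s, by linarith⟩
  have hx : ∀ y : ℤ, (s : ℤ) ∣ y - x ↔ (s : ℤ) ∣ y - r := fun y => by
    rw [show y - r = (y - x) + (x - r) by ring]
    exact (dvd_add_left hxr).symm
  zify
  rw [card_beadsIn, card_beadsIn, ← sub_eq_zero, ← Finset.sum_sub_distrib]
  simp only [hx, ← sub_mul]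
  rw [← Finset.sum_subset (Finset.Icc_subset_Icc hm hn), sum_Icc_neg_natCast]
  · have hres := residue_invariant h r
    rw [sum_parts_eq_sum_range _ hmu, sum_parts_eq_sum_range _ hlam, ← sub_eq_zero,
      ← Finset.sum_sub_distrib] at hres
    refine (Finset.sum_congr rfl fun y _ => ?_).trans hres
    have e : (s : ℤ) ∣ -(y : ℤ) - r ↔ (s : ℤ) ∣ y + r := by
      rw [← dvd_neg, show -(-(y : ℤ) - r) = y + r by ring]
    rcases Nat.eq_zero_or_pos y with rfl | hy
    · simp [beadInd, zero_notMem_beads]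
    · rw [beadInd_neg _ (by omega), beadInd_neg _ (by omega)]
      simp only [e]
      ring
  · simp [beadInd, zero_notMem_beads]
  · intro y _ hy
    simp only [Finset.mem_Icc, not_and_or, not_le] at hy
    rcases hy with hy | hy
    · have e1 := beadInd_neg lam (x := y) (by omega)
      have e2 := beadInd_neg mu (x := y) (by omega)
      rw [beadInd_of_gt hlam (by omega)] at e1
      rw [beadInd_of_gt hmu (by omega)] at e2
      rw [show mu.beadInd y - lam.beadInd y = 0 by linarith, zero_mul]
    · rw [beadInd_of_gt hlam hy, beadInd_of_gt hmu hy]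
      simp

/-- If the bead set is closed under the shift by `-t`, then this shift embeds the beads in the
residue class of `x` into those in the class of `x - t`. -/
theorem card_beadsIn_le {s t : ℕ} {lam : BarPartition} (h : ∀ x ∈ lam.beads, x - t ∈ lam.beads)
    (x m n : ℤ) :
    (lam.beadsIn s x m n).card ≤ (lam.beadsIn s (x - t) (m - t) (n - t)).card := by
  refine Finset.card_le_card_of_injOn (fun y => y - t) ?_ fun y _ z _ hyz => by simpa using hyz
  intro y hy
  rw [Finset.mem_coe, mem_beadsIn] at hy ⊢
  obtain ⟨h1, h2, h3⟩ := hy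
  exact ⟨⟨sub_le_sub_right h1.1 _, sub_le_sub_right h1.2 _⟩, h _ h2, by simpa using h3⟩

/-- If the bead set is closed under the shift by `-s`, then a bead at `x` without a bead at `x - t`
means that the residue class of `x`, in a window containing `x`, has more beads than the class of
`x - t` in the window shifted by `-t`. -/
theorem card_beadsIn_lt {s t : ℕ} {mu : BarPartition} (h : ∀ x ∈ mu.beads, x - s ∈ mu.beads)
    {x m n : ℤ} (hx : x ∈ mu.beads) (hxt : x - t ∉ mu.beads) (hm : m ≤ x) (hn : x ≤ n) :
    (mu.beadsIn s (x - t) (m - t) (n - t)).card < (mu.beadsIn s x m n).card := by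
  have hx' : x ∈ mu.beadsIn s x m n := mem_beadsIn.2 ⟨⟨hm, hn⟩, hx, by simp⟩
  refine lt_of_le_of_lt ?_ (Finset.card_erase_lt_of_mem hx')
  refine Finset.card_le_card_of_injOn (fun y => y + t) ?_ fun y _ z _ hyz => by simpa using hyz
  intro y hy
  rw [Finset.mem_coe, mem_beadsIn] at hy
  obtain ⟨h1, h2, k, hk⟩ := hy
  -- The bead at `y` lies below the empty position `x - t` of its class, so `y + t` lies below `x`.
  have hk0 : k < 0 := by
    by_contra! hk0
    obtain ⟨j, rfl⟩ := Int.eq_ofNat_of_zero_le hk0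
    apply hxt
    have := sub_mul_mem_beads h h2 j
    rwa [show y - s * (j : ℤ) = x - t by linarith] at this
  obtain ⟨j, hj⟩ := Int.eq_ofNat_of_zero_le (show 0 ≤ -k by omega)
  have hy : y + t = x - s * (j : ℤ) := by rw [← hj]; linarith
  have hne : y + t ≠ x := fun e => hxt (by rwa [show x - t = y by linarith])
  change y + t ∈ (mu.beadsIn s x m n).erase x
  rw [Finset.mem_erase, mem_beadsIn]
  refine ⟨hne, by omega, ?_, -(j : ℤ), by linarith⟩
  rw [hy]
  exact sub_mul_mem_beads h hx j

end BarPartition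

open BarPartition in
theorem mainTheorem2 (s t : ℕ) (hs : Odd s) (ht : Odd t) (lam : BarPartition)
    (hlam : lam.IsBarCore t) : (BarPartition.barCore s lam).IsBarCore t := by
  obtain ⟨hred, hcore⟩ := barCore_spec s lam
  rw [isBarCore_iff_beads hs] at hcore
  rw [isBarCore_iff_beads ht] at hlam ⊢
  generalize barCore s lam = mu at *
  intro x hx
  by_contra hxt
  -- The bounds keep `x` in the window and all parts in both the window and its shift by `-t`.
  let N := lam.parts.sup id + mu.parts.sup id + x.natAbs
  have h1 : ∀ a ∈ lam.parts, a ≤ N := fun a ha => by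
    have : a ≤ lam.parts.sup id := Finset.le_sup (f := id) ha
    omega
  have h2 : ∀ a ∈ mu.parts, a ≤ N := fun a ha => by
    have : a ≤ mu.parts.sup id := Finset.le_sup (f := id) ha
    omega
  have hlt := card_beadsIn_lt hcore hx hxt (m := -N) (n := N + t) (by omega) (by omega)
  have hle := card_beadsIn_le (s := s) hlam x (-N) (N + t)
  rw [card_beadsIn_eq hs.pos hred h1 h2 _ (by omega) (by omega),
    card_beadsIn_eq hs.pos hred h1 h2 _ (by omega) (by omega)] at hlt
  omega
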